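/- **Setting.** A universe of separations is a finite lattice $\vec U$ with an order-reversing involution $\vec s\mapsto \vec s^{\,*}$; write $\overleftarrow{s}=\vec s^{\,*}$, and write $s=\{\vec s,\overleftarrow{s}\}$ for the underlying unoriented separation. It is a submodular universe if it carries a function $|\cdot|\colon\vec U\to\mathbb N_0$ with $|\vec s|=|\overleftarrow{s}|=:|s|$ and $|\vec s|+|\vec t|\ge|\vec s\vee\vec t|+|\vec s\wedge\vec t|$ for all $\vec s,\vec t$. For $k\in\mathbb N_0$ let $\vec S_k=\{\vec s\in\vec U:|\vec s|<k\}$, and let $S_k$ be the corresponding set of unoriented separations. An orientation of $S_k$ is a set $O\subseteq\vec S_k$ containing, for every $s\in S_k$, exactly one element of $\{\vec s,\overleftarrow{s}\}$. A profile of $S_k$ is an orientation $P$ such that there are no $\vec r,\vec s\in P$ with $r\ne s$ and $\overleftarrow{r}\le\vec s$ (consistency), and such that $\overleftarrow{r}\wedge\overleftarrow{s}\notin P$ for all $\vec r,\vec s\in P$. It is regular if it contains no $\vec s$ with $\overleftarrow{s}\le\vec s$. A separation $s$ distinguishes $P$ and $P'$ if it has an orientation $\vec s\in P$ with $\overleftarrow{s}\in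 P'$; it does so efficiently if no $r$ with $|r|<|s|$ distinguishes $P$ and $P'$. A star is a set $\sigma\subseteq\vec S_k$ with $\vec s\le\overleftarrow{t}$ for all distinct $\vec s,\vec t\in\sigma$. For a regular profile $P$ of $S_k$, let $\delta_e(P)$ be the minimum size of a star $\sigma\subseteq P$ such that - there are no $\vec s\in\sigma$ and $\vec s\,'\in P$ with $\vec s\le\vec s\,'$ and $|s'|<|s|$, and - every regular profile $P'\neq P$ of $S_k$ contains $\overleftarrow{s}$ for some $\vec s\in\sigma$. An $S_k$-tree $(T,\alpha)$ is a finite tree $T$ with a map $\alpha$ from its oriented edges to $\vec S_k$ satisfying $\alpha(y,x)=\alpha(x,y)^*$ for every edge $xy$. It is irredundant if $\alpha(x,t)\ne\alpha(y,t)$ for distinct neighbours $x,y$ of any node $t$. It is order-respecting if $\alpha(e)\le\alpha(f)$ whenever the path in $T$ from the tail of $e$ to the head of $f$ contains the head of $e$ and the tail of $f$. An efficient tree of tangles for $S_k$ is an irredundant $S_k$-tree such that any two distinct regular profiles of $S_k$ are efficiently distinguished by some edge label. The node of a regular profile $P$ in $(T,\alpha)$ is the unique node $t$ such that $\alpha(x,t)\in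 P$ for all neighbours $x$ of $t$, and the degree of $P$ in $(T,\alpha)$ is the degree of that node in $T$. **Theorem.** Let $\vec U$ be a submodular universe, let $k\in\mathbb N_0$, and let $\mathcal P$ be the set of all regular profiles of $S_k$. Then there is an order-respecting efficient tree of tangles $(T,\alpha)$ for $S_k$ such that every $P\in\mathcal P$ has a node in $(T,\alpha)$ and has degree exactly $\delta_e(P)$ in $(T,\alpha)$ (in particular, $\delta_e(P)$ is well defined), and such that the maximum degree of $T$ is at most $\max\big(\{\delta_e(P):P\in\mathcal P\}\cup\{3\}\big)$. -/

import Mathlib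

/-- A universe of separations: a lattice together with an order-reversing involution `rev`.
De Morgan's law is a consequence of these axioms. Finiteness is assumed separately. -/
class SeparationUniverse (U : Type*) extends Lattice U where
  rev : U → U
  rev_rev : ∀ s : U, rev (rev s) = s
  rev_le_rev_iff : ∀ s t : U, rev t ≤ rev s ↔ s ≤ t

/-- A universe of separations with a submodular order function. -/
class SubmodularUniverse (U : Type*) extends SeparationUniverse U where
  order : U → ℕ
  order_rev : ∀ s : U, order (rev s) = order s
  order_submodular : ∀ s t : U, order (s ⊔ t) + order (s ⊓ t) ≤ order s + order t

namespace SepSys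

open SeparationUniverse SubmodularUniverse

section Universe

variable {U : Type*} [SeparationUniverse U]

/-- `r` and `s` have the same underlying unoriented separation. -/
def SameSep (r s : U) : Prop := r = s ∨ r = rev s

/-- `s` is cosmall, that is, the inverse of a small separation: `rev s ≤ rev (rev s) = s`. -/
def Cosmall (s : U) : Prop := rev s ≤ s

/-- A set of oriented separations is regular if it contains no cosmall separation. -/
def Regular (O : Set U) : Prop := ∀ s ∈ O, ¬ Cosmall s

/-- `O` is an orientation of the separation system `S`: it contains exactly one of the
orientations of every separation in `S`. -/
def IsOrientation (S O : Set U) : Prop :=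
  O ⊆ S ∧ (∀ s ∈ S, (O ∩ {s, rev s}).encard ≤ 1) ∧ ∀ s ∈ S, s ∈ O ∨ rev s ∈ O

def Consistent (O : Set U) : Prop :=
  ¬ ∃ r ∈ O, ∃ s ∈ O, rev r ≤ s ∧ ¬ SameSep r s

/-- A profile of `S` is a consistent orientation of `S` with the profile property. -/
def IsProfile (S P : Set U) : Prop :=
  IsOrientation S P ∧ Consistent P ∧ ∀ r ∈ P, ∀ s ∈ P, rev r ⊓ rev s ∉ P

def IsRegularProfile (S P : Set U) : Prop := IsProfile S P ∧ Regular P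

/-- A star: distinct elements point towards each other. -/
def IsStar (σ : Set U) : Prop := ∀ s ∈ σ, ∀ t ∈ σ, s ≠ t → s ≤ rev t

def Distinguishes (s : U) (O₁ O₂ : Set U) : Prop :=
  (s ∈ O₁ ∧ rev s ∈ O₂) ∨ (rev s ∈ O₁ ∧ s ∈ O₂)

/-- The natural partial order on the oriented edges of a tree: `e ≤ f` if the path from the tail
of `e` to the head of `f` contains the head of `e` and the tail of `f`. -/
def DartLE {V : Type*} {G : SimpleGraph V} (e f : G.Dart) : Prop :=
  ∃ p : G.Walk e.fst f.snd, p.IsPath ∧ e.snd ∈ p.support ∧ f.fst ∈ p.support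

/-- An `S`-tree: a finite tree whose oriented edges are labelled by elements of `S`, such that
the labelling commutes with reversal. -/
structure STree (S : Set U) where
  V : Type
  finite : Finite V
  graph : SimpleGraph V
  isTree : graph.IsTree
  label : graph.Dart → U
  label_mem : ∀ e, label e ∈ S
  label_symm : ∀ e, label e.symm = rev (label e)

namespace STree

variable {S : Set U}

/-- Distinct oriented edges with the same head have distinct labels. -/
def Irredundant (T : STree S) : Prop :=
  ∀ e f : T.graph.Dart, e.snd = f.snd → e.fst ≠ f.fst → T.label e ≠ T.label f

def OrderRespecting (T : STree S) : Prop :=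
  ∀ e f : T.graph.Dart, DartLE e f → T.label e ≤ T.label f

/-- The number of neighbours of a node. -/
noncomputable def degree (T : STree S) (v : T.V) : ℕ∞ := (T.graph.neighborSet v).encard

/-- A tree of tangles for `S`: an irredundant `S`-tree whose set of edge labels distinguishes any
two regular profiles of `S`. -/
def IsTreeOfTangles (T : STree S) : Prop :=
  T.Irredundant ∧
    ∀ P₁ P₂ : Set U, IsRegularProfile S P₁ → IsRegularProfile S P₂ → P₁ ≠ P₂ →
      ∃ e : T.graph.Dart, Distinguishes (T.label e) P₁ P₂

/-- `v` is a sink of the orientation of the edges induced by `P`: every edge at `v`, oriented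
towards `v`, has its label in `P`. -/
def IsSink (T : STree S) (P : Set U) (v : T.V) : Prop :=
  ∀ e : T.graph.Dart, e.snd = v → T.label e ∈ P

/-- `v` is the node of `P`: the unique sink of the orientation induced by `P`. -/
def IsNodeOf (T : STree S) (P : Set U) (v : T.V) : Prop :=
  T.IsSink P v ∧ ∀ w, T.IsSink P w → w = v

end STree

end Universe

section Submodular

variable {U : Type*} [SubmodularUniverse U]

/-- The separation system of all separations of order less than `k`. -/
def Sk (U : Type*) [SubmodularUniverse U] (k : ℕ) : Set U := {s | order s < k}

def EffDistinguishes (s : U) (O₁ O₂ : Set U) : Prop :=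
  Distinguishes s O₁ O₂ ∧ ¬ ∃ r : U, order r < order s ∧ Distinguishes r O₁ O₂

/-- A tree of tangles is efficient if its edge labels distinguish any two regular profiles
efficiently. -/
def STree.IsEfficientTreeOfTangles {S : Set U} (T : STree S) : Prop :=
  T.IsTreeOfTangles ∧
    ∀ P₁ P₂ : Set U, IsRegularProfile S P₁ → IsRegularProfile S P₂ → P₁ ≠ P₂ →
      ∃ e : T.graph.Dart, EffDistinguishes (T.label e) P₁ P₂

/-- The property `Eff(P)` of a star. -/
def Eff (P σ : Set U) : Prop := ¬ ∃ s ∈ σ, ∃ s' ∈ P, s ≤ s' ∧ order s' < order s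

/-- `σ` is a star in `P` with property `Eff(P)` that distinguishes `P` from all other regular
profiles of `Sk U k`. -/
def IsEffStarFor (k : ℕ) (P σ : Set U) : Prop :=
  σ ⊆ P ∧ IsStar σ ∧ Eff P σ ∧
    ∀ P' : Set U, IsRegularProfile (Sk U k) P' → P' ≠ P → ∃ s ∈ σ, rev s ∈ P'

/-- The minimal size of a star as in `IsEffStarFor`. It is an extended natural number: it would
be `⊤` if there were no such star. -/
noncomputable def deltaE (k : ℕ) (P : Set U) : ℕ∞ :=
  ⨅ (σ : Set U) (_ : IsEffStarFor k P σ), σ.encard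

/-- The maximum of `deltaE k P` over all regular profiles `P` of `Sk U k` (zero if there are
none). -/
noncomputable def deltaEMax (U : Type*) [SubmodularUniverse U] (k : ℕ) : ℕ∞ :=
  ⨆ (P : Set U) (_ : IsRegularProfile (Sk U k) P), deltaE k P

end Submodular

end SepSys

/-!
Fix a set `A` of forbidden separations that is up-closed in `Sk U k`, and allow leaves carrying a
singleton `{a}` with `a ∈ A`. By downward induction on `A` there is a tree whose node stars are
such leaves, optimal stars for the regular profiles that avoid `A`, or small stars contained in no
regular profile, and which efficiently distinguishes the profiles that avoid `A`. The theorem is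
the case `A = ∅`.

If `A` contains an orientation of every separation, at most one profile avoids `A`. Either `A`
contains both orientations of some separation, and two leaves suffice; or the complement of `A` is
an orientation, and then it is a regular profile, with an optimal star, unless it contains a
cosmall separation or a corner star violating the profile property, which by submodularity can be
chosen inside `Sk U k`.

Otherwise let `t` be a separation of minimal order with neither orientation in `A`. Let `r` be
maximal outside `A` with `rev t ≤ r`, and take a tree for `A ∪ {r}`. If it has no leaf `{r}`, it is
a tree for `A`. If it has one, reroot it there and shift all its labels by `t`. As `t` has minimal
order, it is linked to `rev r`, so shifting raises no orders, and optimal stars of profiles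
containing `t` stay optimal. This gives a branch starting at `t`. Proceed likewise with `rev t`,
and glue the two branches along `t`.
-/

namespace SepSys

open SeparationUniverse SubmodularUniverse

section Universe

variable {U : Type*} [SeparationUniverse U] {S P Q σ : Set U} {p r s t : U}

theorem rev_le_iff : rev s ≤ t ↔ rev t ≤ s := by
  rw [← rev_le_rev_iff (rev s) t, rev_rev]

theorem le_rev_iff : s ≤ rev t ↔ t ≤ rev s := by
  rw [← rev_le_rev_iff s (rev t), rev_rev]

theorem rev_antitone : Antitone (rev : U → U) := fun _ _ h => (rev_le_rev_iff _ _).2 h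

theorem rev_injective : Function.Injective (rev : U → U) :=
  Function.LeftInverse.injective (g := rev) rev_rev

theorem rev_sup (s t : U) : rev (s ⊔ t) = rev s ⊓ rev t :=
  le_antisymm (le_inf (rev_antitone le_sup_left) (rev_antitone le_sup_right))
    (le_rev_iff.1 (sup_le (le_rev_iff.1 inf_le_left) (le_rev_iff.1 inf_le_right)))

theorem rev_inf (s t : U) : rev (s ⊓ t) = rev s ⊔ rev t := by
  conv_lhs => rw [← rev_rev s, ← rev_rev t, ← rev_sup, rev_rev]

theorem rev_inf_rev (s t : U) : rev (s ⊓ rev t) = rev s ⊔ t := by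
  rw [rev_inf, rev_rev]

theorem distinguishes_comm : Distinguishes s P Q ↔ Distinguishes s Q P := by
  unfold Distinguishes
  tauto

theorem distinguishes_rev_iff : Distinguishes (rev s) P Q ↔ Distinguishes s P Q := by
  rw [Distinguishes, Distinguishes, rev_rev, or_comm]

theorem isStar_singleton (s : U) : IsStar {s} := by
  rintro _ rfl _ rfl h
  exact absurd rfl h

namespace IsRegularProfile

theorem subset (hP : IsRegularProfile S P) : P ⊆ S := hP.1.1.1

theorem mem_or_rev_mem (hP : IsRegularProfile S P) (hs : s ∈ S) : s ∈ P ∨ rev s ∈ P :=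
  hP.1.1.2.2 s hs

theorem rev_mem (hP : IsRegularProfile S P) (hs : s ∈ S) (hsP : s ∉ P) : rev s ∈ P :=
  (hP.mem_or_rev_mem hs).resolve_left hsP

theorem not_cosmall (hP : IsRegularProfile S P) (hs : s ∈ P) : ¬ Cosmall s := hP.2 s hs

theorem rev_notMem (hP : IsRegularProfile S P) (hs : s ∈ P) : rev s ∉ P := by
  intro hrev
  have hself : s = rev s := Set.encard_le_one_iff.1 (hP.1.1.2.1 s (hP.subset hs)) s (rev s)
    ⟨hs, by simp⟩ ⟨hrev, by simp⟩
  exact hP.not_cosmall hs hself.symm.le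

theorem mem_of_le (hP : IsRegularProfile S P) (hs : s ∈ P) (ht : t ∈ S) (hts : t ≤ s) :
    t ∈ P := by
  by_contra htP
  refine hP.1.2.1 ⟨rev t, hP.rev_mem ht htP, s, hs, by rwa [rev_rev], ?_⟩
  rintro (heq | heq)
  · exact hP.not_cosmall hs (by rw [← heq, Cosmall, rev_rev, heq]; exact hts)
  · exact htP (rev_injective heq ▸ hs)

theorem sup_mem (hP : IsRegularProfile S P) (hs : s ∈ P) (ht : t ∈ P) (hst : s ⊔ t ∈ S) :
    s ⊔ t ∈ P := by
  by_contra hstP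
  exact hP.1.2.2 s hs t ht (rev_sup s t ▸ hP.rev_mem hst hstP)

theorem exists_mem_rev_mem_of_ne (hP : IsRegularProfile S P) (hQ : IsRegularProfile S Q)
    (hQP : Q ≠ P) : ∃ s ∈ P, rev s ∈ Q := by
  by_contra! hno
  refine hQP (Set.Subset.antisymm (fun s hs => ?_) fun s hs => ?_)
  · refine (hP.mem_or_rev_mem (hQ.subset hs)).resolve_right fun h => hno _ h ?_
    rwa [rev_rev]
  · exact (hQ.mem_or_rev_mem (hP.subset hs)).resolve_right (hno s hs)

end IsRegularProfile

/-- `σ` is a subset of `P` that distinguishes `P` from every other regular profile of `S`. -/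
def Isolates (S P σ : Set U) : Prop :=
  σ ⊆ P ∧ ∀ Q, IsRegularProfile S Q → Q ≠ P → ∃ s ∈ σ, rev s ∈ Q

theorem IsRegularProfile.isolates_self (hP : IsRegularProfile S P) : Isolates S P P :=
  ⟨Set.Subset.rfl, fun _ hQ hQP => hP.exists_mem_rev_mem_of_ne hQ hQP⟩

theorem Isolates.eq_of_subset (hσ : Isolates S P σ) (hQ : IsRegularProfile S Q) (hσQ : σ ⊆ Q) :
    Q = P := by
  by_contra hQP
  obtain ⟨s, hs, hsQ⟩ := hσ.2 Q hQ hQP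
  exact hQ.rev_notMem (hσQ hs) hsQ

theorem Isolates.insert_sdiff_singleton (hσ : Isolates S P σ) (ht : t ∈ P)
    (hst : ∀ Q, IsRegularProfile S Q → rev s ∈ Q → ∃ x ∈ insert t (σ \ {s}), rev x ∈ Q) :
    Isolates S P (insert t (σ \ {s})) := by
  refine ⟨Set.insert_subset ht (Set.sdiff_subset.trans hσ.1), fun Q hQ hQP => ?_⟩
  obtain ⟨x, hx, hxQ⟩ := hσ.2 Q hQ hQP
  obtain rfl | hxs := eq_or_ne x s
  · exact hst Q hQ hxQ
  · exact ⟨x, .inr ⟨hx, hxs⟩, hxQ⟩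

end Universe

section Order

variable {U : Type*} [SubmodularUniverse U] {k : ℕ} {P Q : Set U} {p q r s t : U}

theorem rev_mem_Sk (hs : s ∈ Sk U k) : rev s ∈ Sk U k := (order_rev s).trans_lt hs

theorem mem_Sk_of_order_le (hst : order s ≤ order t) (ht : t ∈ Sk U k) : s ∈ Sk U k :=
  hst.trans_lt ht

theorem IsRegularProfile.rev_mem_of_le (hQ : IsRegularProfile (Sk U k) Q) (hs : rev s ∈ Q)
    (ht : t ∈ Sk U k) (hst : s ≤ t) : rev t ∈ Q :=
  hQ.mem_of_le hs (rev_mem_Sk ht) (rev_antitone hst)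

theorem IsRegularProfile.rev_inf_rev_mem (hQ : IsRegularProfile (Sk U k) Q) (hs : rev s ∈ Q)
    (ht : t ∈ Q) (hst : s ⊓ rev t ∈ Sk U k) : rev (s ⊓ rev t) ∈ Q := by
  have hrev := rev_mem_Sk hst
  rw [rev_inf_rev] at hrev ⊢
  exact hQ.sup_mem hs ht hrev

theorem order_inf_rev (s t : U) : order (s ⊓ rev t) = order (rev s ⊔ t) := by
  rw [← order_rev, rev_inf_rev]

theorem order_inf_rev_le_or (s t : U) :
    order (s ⊓ rev t) ≤ order s ∨ order (t ⊓ rev s) ≤ order t := by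
  have hsub := order_submodular s (rev t)
  rw [order_rev] at hsub
  rw [order_inf_rev t s, sup_comm]
  omega

theorem effDistinguishes_comm : EffDistinguishes s P Q ↔ EffDistinguishes s Q P := by
  simp only [EffDistinguishes, distinguishes_comm (P := P)]

theorem effDistinguishes_rev_iff : EffDistinguishes (rev s) P Q ↔ EffDistinguishes s P Q := by
  simp only [EffDistinguishes, distinguishes_rev_iff, order_rev]

theorem EffDistinguishes.sup (h : EffDistinguishes s P Q) (hP : IsRegularProfile (Sk U k) P)
    (hQ : IsRegularProfile (Sk U k) Q) (hsP : s ∈ P) (hsQ : rev s ∈ Q) (hpP : p ∈ P)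
    (hsp : order (s ⊔ p) ≤ order s) : EffDistinguishes (s ⊔ p) P Q := by
  have hspk : s ⊔ p ∈ Sk U k := mem_Sk_of_order_le hsp (hP.subset hsP)
  exact ⟨.inl ⟨hP.sup_mem hsP hpP hspk, hQ.rev_mem_of_le hsQ hspk le_sup_left⟩,
    fun ⟨x, hx, hxPQ⟩ => h.2 ⟨x, hx.trans_le hsp, hxPQ⟩⟩

/-- The separation `p` is linked to `q`: taking the supremum with `p` does not increase the order
of any separation above `q`. -/
def Linked (q p : U) : Prop := q ≤ p ∧ ∀ x, q ≤ x → order (x ⊔ p) ≤ order x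

theorem linked_of_forall_order_le (hqp : q ≤ p) (hp : ∀ x, q ≤ x → x ≤ p → order p ≤ order x) :
    Linked q p := by
  refine ⟨hqp, fun x hqx => ?_⟩
  have hsub := order_submodular x p
  have hmin := hp (x ⊓ p) (le_inf hqx hqp) inf_le_right
  omega

theorem Linked.order_inf_rev_le (hqp : Linked q p) (hs : q ≤ rev s) :
    order (s ⊓ rev p) ≤ order s :=
  calc order (s ⊓ rev p) = order (rev s ⊔ p) := order_inf_rev s p
    _ ≤ order (rev s) := hqp.2 _ hs
    _ = order s := order_rev s

end Order

section EffStar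

variable {U : Type*} [SubmodularUniverse U] {k : ℕ} {P σ : Set U} {s t : U}

theorem isEffStarFor_iff :
    IsEffStarFor k P σ ↔ Isolates (Sk U k) P σ ∧ IsStar σ ∧ Eff P σ := by
  unfold IsEffStarFor Isolates
  tauto

/-- A weight whose order is lexicographic: separations are compared by their order first and by the
size of their down-closure second. -/
noncomputable def starWeight (s : U) : ℕ := order s * (Nat.card U + 1) + (Set.Iic s).ncard

theorem starWeight_lt_of_order_lt [Finite U] (hst : order s < order t) :
    starWeight s < starWeight t :=
  calc starWeight s < order s * (Nat.card U + 1) + (Nat.card U + 1) :=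
        Nat.add_lt_add_left (Nat.lt_succ_of_le (Set.ncard_le_card _)) _
    _ = (order s + 1) * (Nat.card U + 1) := by ring
    _ ≤ order t * (Nat.card U + 1) := Nat.mul_le_mul_right _ hst
    _ ≤ starWeight t := Nat.le_add_right _ _

theorem starWeight_lt_of_lt [Finite U] (ho : order s ≤ order t) (hst : s < t) :
    starWeight s < starWeight t :=
  Nat.add_lt_add_of_le_of_lt (Nat.mul_le_mul_right _ ho)
    (Set.ncard_lt_ncard (Set.Iic_ssubset_Iic.2 hst))

theorem exists_isolates_forall_replacement [Finite U] (hP : IsRegularProfile (Sk U k) P) :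
    ∃ σ, Isolates (Sk U k) P σ ∧ ∀ s ∈ σ, ∀ t, starWeight t < starWeight s →
      ¬ Isolates (Sk U k) P (insert t (σ \ {s})) := by
  classical
  have := Fintype.ofFinite U
  obtain ⟨σ, hσ, hmin⟩ := (Set.toFinite {σ : Finset U | Isolates (Sk U k) P σ}).exists_minimalFor
    (fun σ => ∑ s ∈ σ, starWeight s) _ ⟨P.toFinset, by simpa using hP.isolates_self⟩
  refine ⟨σ, hσ, fun s hs t hts hiso => ?_⟩
  have hlt : ∑ x ∈ insert t (σ.erase s), starWeight x < ∑ x ∈ σ, starWeight x :=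
    calc ∑ x ∈ insert t (σ.erase s), starWeight x
        ≤ starWeight t + ∑ x ∈ σ.erase s, starWeight x := by
          by_cases ht : t ∈ σ.erase s
          · rw [Finset.insert_eq_of_mem ht]
            exact Nat.le_add_left _ _
          · exact (Finset.sum_insert ht).le
      _ < starWeight s + ∑ x ∈ σ.erase s, starWeight x := Nat.add_lt_add_right hts _
      _ = ∑ x ∈ σ, starWeight x := Finset.add_sum_erase σ starWeight hs
  exact (hmin (j := insert t (σ.erase s)) (by simpa using hiso) hlt.le).not_gt hlt

theorem isStar_of_forall_replacement [Finite U] (hP : IsRegularProfile (Sk U k) P)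
    (hσ : Isolates (Sk U k) P σ)
    (hmin : ∀ s ∈ σ, ∀ t, starWeight t < starWeight s →
      ¬ Isolates (Sk U k) P (insert t (σ \ {s}))) : IsStar σ := by
  have key : ∀ s ∈ σ, ∀ t ∈ σ, s ≠ t → order (s ⊓ rev t) ≤ order s → s ≤ rev t := by
    intro s hs t ht hst ho
    by_contra hle
    have hsk : s ⊓ rev t ∈ Sk U k := mem_Sk_of_order_le ho (hP.subset (hσ.1 hs))
    refine hmin s hs _ (starWeight_lt_of_lt ho (inf_lt_left.2 hle)) <|
      hσ.insert_sdiff_singleton (hP.mem_of_le (hσ.1 hs) hsk inf_le_left) fun Q hQ hsQ => ?_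
    by_cases htQ : t ∈ Q
    · exact ⟨_, .inl rfl, hQ.rev_inf_rev_mem hsQ htQ hsk⟩
    · exact ⟨t, .inr ⟨ht, hst.symm⟩, hQ.rev_mem (hP.subset (hσ.1 ht)) htQ⟩
  intro s hs t ht hst
  obtain h | h := order_inf_rev_le_or s t
  · exact key s hs t ht hst h
  · exact le_rev_iff.1 (key t ht s hs hst.symm h)

theorem eff_of_forall_replacement [Finite U] (hP : IsRegularProfile (Sk U k) P)
    (hσ : Isolates (Sk U k) P σ)
    (hmin : ∀ s ∈ σ, ∀ t, starWeight t < starWeight s →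
      ¬ Isolates (Sk U k) P (insert t (σ \ {s}))) : Eff P σ := by
  rintro ⟨s, hs, t, ht, hst, hlt⟩
  refine hmin s hs t (starWeight_lt_of_order_lt hlt) <|
    hσ.insert_sdiff_singleton ht fun Q hQ hsQ =>
      ⟨t, .inl rfl, hQ.rev_mem_of_le hsQ (hP.subset ht) hst⟩

theorem exists_isEffStarFor [Finite U] (hP : IsRegularProfile (Sk U k) P) :
    ∃ σ, IsEffStarFor k P σ := by
  obtain ⟨σ, hσ, hmin⟩ := exists_isolates_forall_replacement hP
  exact ⟨σ, isEffStarFor_iff.2 ⟨hσ, isStar_of_forall_replacement hP hσ hmin,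
    eff_of_forall_replacement hP hσ hmin⟩⟩

theorem exists_isEffStarFor_encard_eq [Finite U] (hP : IsRegularProfile (Sk U k) P) :
    ∃ σ, IsEffStarFor k P σ ∧ σ.encard = deltaE k P := by
  obtain ⟨σ, hσ, hmin⟩ := (Set.toFinite {σ : Set U | IsEffStarFor k P σ}).exists_minimalFor
    Set.encard _ (exists_isEffStarFor hP)
  refine ⟨σ, hσ, le_antisymm (le_iInf₂ fun τ hτ => ?_) (iInf₂_le σ hσ)⟩
  exact (le_total σ.encard τ.encard).elim id (hmin hτ)

theorem deltaE_le_deltaEMax (hP : IsRegularProfile (Sk U k) P) : deltaE k P ≤ deltaEMax U k :=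
  le_iSup₂ (f := fun P (_ : IsRegularProfile (Sk U k) P) => deltaE k P) P hP

end EffStar

section ShiftStar

variable {U : Type*} [SeparationUniverse U] {σ : Set U} {s : U}

/-- The star obtained from `σ` by enlarging its element `s` to `s ⊔ p` and restricting all other
elements to `rev p`. -/
def shiftStar (σ : Set U) (s p : U) : Set U := insert (s ⊔ p) ((· ⊓ rev p) '' (σ \ {s}))

theorem shiftStar_singleton (s p : U) : shiftStar {s} s p = {s ⊔ p} := by
  simp [shiftStar]

theorem IsStar.shiftStar (hσ : IsStar σ) (hs : s ∈ σ) (p : U) : IsStar (shiftStar σ s p) := by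
  have hinf : ∀ t ∈ σ \ {s}, t ⊓ rev p ≤ rev (s ⊔ p) := fun t ht => by
    rw [rev_sup]
    exact inf_le_inf_right _ (hσ t ht.1 s hs ht.2)
  rintro _ (rfl | ⟨t, ht, rfl⟩) _ (rfl | ⟨u, hu, rfl⟩) hne
  · exact absurd rfl hne
  · exact le_rev_iff.1 (hinf u hu)
  · exact hinf t ht
  · exact inf_le_left.trans ((hσ t ht.1 u hu.1 fun h => hne (by rw [h])).trans
      (rev_antitone inf_le_left))

theorem encard_shiftStar_le (hs : s ∈ σ) (p : U) : (shiftStar σ s p).encard ≤ σ.encard :=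
  calc (shiftStar σ s p).encard ≤ ((· ⊓ rev p) '' (σ \ {s})).encard + 1 :=
        Set.encard_insert_le _ _
    _ ≤ (σ \ {s}).encard + 1 := add_le_add_left (Set.encard_image_le _ _) 1
    _ = σ.encard := Set.encard_sdiff_singleton_add_one hs

end ShiftStar

section ShiftEffStar

variable {U : Type*} [SubmodularUniverse U] {k : ℕ} {P Q σ : Set U} {p q s t : U}

theorem shiftStar_subset_Sk (hqp : Linked q p) (hσ : IsStar σ) (hσk : σ ⊆ Sk U k) (hs : s ∈ σ)
    (hqs : q ≤ s) : shiftStar σ s p ⊆ Sk U k := by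
  rintro _ (rfl | ⟨t, ⟨ht, hts⟩, rfl⟩)
  · exact mem_Sk_of_order_le (hqp.2 s hqs) (hσk hs)
  · exact mem_Sk_of_order_le (hqp.order_inf_rev_le (hqs.trans (hσ s hs t ht (Ne.symm hts))))
      (hσk ht)

theorem mem_of_shiftStar_subset (hp : p ∈ Sk U k) (hQ : IsRegularProfile (Sk U k) Q)
    (hσQ : shiftStar σ s p ⊆ Q) : p ∈ Q :=
  hQ.mem_of_le (hσQ (.inl rfl)) hp le_sup_right

theorem subset_of_shiftStar_subset (hp : p ∈ Sk U k) (hσk : σ ⊆ Sk U k)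
    (hQ : IsRegularProfile (Sk U k) Q) (hσQ : shiftStar σ s p ⊆ Q) : σ ⊆ Q := by
  intro t ht
  obtain rfl | hts := eq_or_ne t s
  · exact hQ.mem_of_le (hσQ (.inl rfl)) (hσk ht) le_sup_left
  · have htQ : t ⊓ rev p ∈ Q := hσQ (.inr ⟨t, ⟨ht, hts⟩, rfl⟩)
    by_contra hnot
    exact hQ.rev_notMem htQ (hQ.rev_inf_rev_mem (hQ.rev_mem (hσk ht) hnot)
      (mem_of_shiftStar_subset hp hQ hσQ) (hQ.subset htQ))

theorem Isolates.shiftStar (hσ : Isolates (Sk U k) P σ) (hP : IsRegularProfile (Sk U k) P)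
    (hpP : p ∈ P) (hσk : shiftStar σ s p ⊆ Sk U k) (hs : s ∈ σ) :
    Isolates (Sk U k) P (shiftStar σ s p) := by
  have hspk : s ⊔ p ∈ Sk U k := hσk (.inl rfl)
  constructor
  · rintro x hx
    obtain rfl | ⟨t, ⟨ht, -⟩, rfl⟩ := id hx
    · exact hP.sup_mem (hσ.1 hs) hpP hspk
    · exact hP.mem_of_le (hσ.1 ht) (hσk hx) inf_le_left
  · intro Q hQ hQP
    by_cases hpQ : p ∈ Q
    · obtain ⟨t, ht, htQ⟩ := hσ.2 Q hQ hQP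
      obtain rfl | hts := eq_or_ne t s
      · exact ⟨_, .inl rfl, hQ.rev_mem_of_le htQ hspk le_sup_left⟩
      · have htσ : t ⊓ rev p ∈ SepSys.shiftStar σ s p := .inr ⟨t, ⟨ht, hts⟩, rfl⟩
        exact ⟨_, htσ, hQ.rev_inf_rev_mem htQ hpQ (hσk htσ)⟩
    · exact ⟨_, .inl rfl,
        hQ.rev_mem_of_le (hQ.rev_mem (hP.subset hpP) hpQ) hspk le_sup_right⟩

theorem Linked.order_inf_rev_le_of_eff (hqp : Linked q p) (hP : IsRegularProfile (Sk U k) P)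
    (hσP : σ ⊆ P) (heff : Eff P σ) (ht : t ∈ σ) (hqt : q ≤ rev t) {u : U} (hu : u ∈ P)
    (htu : t ⊓ rev p ≤ u) : order (t ⊓ rev p) ≤ order u := by
  have hsup : order t ≤ order (t ⊔ u) := by
    by_contra! hlt
    exact heff ⟨t, ht, t ⊔ u, hP.sup_mem (hσP ht) hu (hlt.trans (hP.subset (hσP ht))),
      le_sup_left, hlt⟩
  have hinf : order (t ⊓ rev p) ≤ order (t ⊓ u) :=
    calc order (t ⊓ rev p) = order ((t ⊓ u) ⊓ rev p) := by
          rw [inf_right_comm, inf_eq_left.2 htu]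
      _ ≤ order (t ⊓ u) := hqp.order_inf_rev_le (hqt.trans (rev_antitone inf_le_left))
  have hsub := order_submodular t u
  omega

theorem Eff.shiftStar (heff : Eff P σ) (hP : IsRegularProfile (Sk U k) P) (hσP : σ ⊆ P)
    (hσ : IsStar σ) (hqp : Linked q p) (hs : s ∈ σ) (hqs : q ≤ s) :
    Eff P (shiftStar σ s p) := by
  rintro ⟨_, rfl | ⟨t, ⟨ht, hts⟩, rfl⟩, u, hu, hle, hlt⟩
  · exact heff ⟨s, hs, u, hu, le_sup_left.trans hle, hlt.trans_le (hqp.2 s hqs)⟩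
  · exact hlt.not_ge (hqp.order_inf_rev_le_of_eff hP hσP heff ht
      (hqs.trans (hσ s hs t ht (Ne.symm hts))) hu hle)

theorem IsEffStarFor.shiftStar (hσ : IsEffStarFor k P σ) (hP : IsRegularProfile (Sk U k) P)
    (hpP : p ∈ P) (hqp : Linked q p) (hs : s ∈ σ) (hqs : q ≤ s) :
    IsEffStarFor k P (shiftStar σ s p) := by
  obtain ⟨hiso, hstar, heff⟩ := isEffStarFor_iff.1 hσ
  have hσk := shiftStar_subset_Sk hqp hstar (hiso.1.trans hP.subset) hs hqs
  exact isEffStarFor_iff.2 ⟨hiso.shiftStar hP hpP hσk hs, hstar.shiftStar hs p,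
    heff.shiftStar hP hiso.1 hstar hqp hs hqs⟩

end ShiftEffStar

section Branch

variable {U : Type*} [SeparationUniverse U] {F F' : Set U → Prop} {D E σ : Set U} {r s t : U}

/-- The set of all orientations of separations in `E`. -/
def symmClosure (E : Set U) : Set U := E ∪ rev ⁻¹' E

theorem symmClosure_subset_iff : symmClosure D ⊆ symmClosure E ↔ D ⊆ symmClosure E := by
  refine ⟨fun h e he => h (.inl he), fun h e he => ?_⟩
  obtain he | he := he
  · exact h he
  · have := h he
    simp only [symmClosure, Set.mem_union, Set.mem_preimage, rev_rev] at this ⊢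
    exact this.symm

/-- `Branch F s E`: there is a finite tree with a distinguished leaf whose edge, pointing away from
that leaf, is labelled `s`, whose other nodes carry stars satisfying `F`, and whose edge labels,
pointing away from that leaf, form the set `E`. -/
inductive Branch (F : Set U → Prop) : U → Set U → Prop
  | mk (σ : Set U) (s : U) (E : U → Set U) (hσ : F σ) (hs : s ∈ σ)
      (h : ∀ t ∈ σ, t ≠ s → Branch F (rev t) (E t)) :
      Branch F s (insert s (⋃ t ∈ σ \ {s}, E t))

/-- `TreeOver F E`: there is a finite tree whose nodes carry stars satisfying `F` and whose edge
labels include every separation in `E` in some orientation. -/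
def TreeOver (F : Set U → Prop) (E : Set U) : Prop :=
  ∃ σ, F σ ∧ ∃ D : U → Set U, (∀ t ∈ σ, Branch F (rev t) (D t)) ∧ E ⊆ symmClosure (⋃ t ∈ σ, D t)

theorem Branch.self_mem (h : Branch F s E) : s ∈ E := by
  cases h
  exact Set.mem_insert _ _

theorem Branch.le (hF : ∀ σ, F σ → IsStar σ) (h : Branch F s E) : ∀ e ∈ E, s ≤ e := by
  induction h with
  | mk σ s E hσ hs h ih =>
    rintro e (rfl | he)
    · exact le_rfl
    · obtain ⟨t, ⟨ht, hts⟩, he⟩ := Set.mem_iUnion₂.1 he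
      exact (hF σ hσ s hs t ht (Ne.symm hts)).trans (ih t ht hts e he)

theorem Branch.leaf (h : F {s}) : Branch F s {s} := by
  simpa using Branch.mk {s} s (fun _ => ∅) h rfl fun t ht hts => absurd ht hts

theorem Branch.mono (hF : ∀ σ, F σ → F' σ) (h : Branch F s E) : Branch F' s E := by
  induction h with
  | mk σ s E hσ hs _ ih => exact .mk σ s E (hF σ hσ) hs ih

theorem TreeOver.mono (hF : ∀ σ, F σ → F' σ) (h : TreeOver F E) : TreeOver F' E := by
  obtain ⟨σ, hσ, D, hD, hE⟩ := h
  exact ⟨σ, hF σ hσ, D, fun t ht => (hD t ht).mono hF, hE⟩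

theorem forall_branch_update [DecidableEq U] {E : U → Set U}
    (hE : ∀ t ∈ σ, t ≠ s → Branch F (rev t) (E t)) (hD : Branch F (rev s) D) :
    ∀ t ∈ σ, Branch F (rev t) (Function.update E s D t) := by
  intro t ht
  obtain rfl | hts := eq_or_ne t s
  · rwa [Function.update_self]
  · rw [Function.update_of_ne hts]
    exact hE t ht hts

theorem branch_union_subset_symmClosure [DecidableEq U] (hs : s ∈ σ) (E : U → Set U)
    (hsD : rev s ∈ D) :
    insert s (⋃ t ∈ σ \ {s}, E t) ∪ D ⊆ symmClosure (⋃ t ∈ σ, Function.update E s D t) := by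
  have hD : D ⊆ ⋃ t ∈ σ, Function.update E s D t := fun e he =>
    Set.mem_biUnion hs (by rwa [Function.update_self])
  rintro e ((rfl | he) | he)
  · exact .inr (hD hsD)
  · obtain ⟨t, ⟨ht, hts⟩, he⟩ := Set.mem_iUnion₂.1 he
    exact .inl (Set.mem_biUnion ht (by rwa [Function.update_of_ne hts]))
  · exact .inl (hD he)

theorem biUnion_subset_union_insert {α : Type*} (σ : Set α) (D : α → Set α) (t : α) :
    ⋃ x ∈ σ, D x ⊆ D t ∪ insert t (⋃ x ∈ σ \ {t}, D x) := by
  intro e he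
  obtain ⟨x, hx, he⟩ := Set.mem_iUnion₂.1 he
  obtain rfl | hxt := eq_or_ne x t
  · exact .inl he
  · exact .inr (.inr (Set.mem_biUnion (x := x) ⟨hx, hxt⟩ he))

theorem Branch.glue (h : Branch F s E) (h' : Branch F (rev s) D) : TreeOver F (E ∪ D) := by
  classical
  cases h with
  | mk σ _ E hσ hs h =>
    exact ⟨σ, hσ, _, forall_branch_update h h', branch_union_subset_symmClosure hs E h'.self_mem⟩

theorem Branch.reroot (h : Branch F s E) (hD : Branch F (rev s) D) :
    Branch (fun σ => F σ ∧ σ ≠ {r}) s E ∨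
      ∃ E', Branch F (rev r) E' ∧ E ∪ D ⊆ symmClosure E' := by
  classical
  induction h generalizing D with
  | mk σ s E hσ hs h ih =>
    have hfull := forall_branch_update h hD
    have hcover := branch_union_subset_symmClosure hs E hD.self_mem
    by_cases hgood : ∀ t ∈ σ, t ≠ s → Branch (fun σ => F σ ∧ σ ≠ {r}) (rev t) (E t)
    · obtain rfl | hσr := eq_or_ne σ {r}
      · obtain rfl : s = r := hs
        exact .inr ⟨D, hD, by simpa only [Set.biUnion_singleton, Function.update_self] using hcover⟩
      · exact .inl (.mk σ s E ⟨hσ, hσr⟩ hs hgood)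
    · push Not at hgood
      obtain ⟨t, ht, hts, hbad⟩ := hgood
      have hback := Branch.mk σ t _ hσ ht fun x hx _ => hfull x hx
      obtain ⟨E', hE', hsub⟩ := (ih t ht hts (by rwa [rev_rev])).resolve_left hbad
      have hunion := biUnion_subset_union_insert σ (Function.update E s D) t
      rw [Function.update_of_ne hts] at hunion
      exact .inr ⟨E', hE', hcover.trans (symmClosure_subset_iff.2 (hunion.trans hsub))⟩

theorem TreeOver.reroot (h : TreeOver F E) :
    TreeOver (fun σ => F σ ∧ σ ≠ {r}) E ∨ ∃ E', Branch F (rev r) E' ∧ E ⊆ symmClosure E' := by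
  obtain ⟨σ, hσ, D, hD, hE⟩ := h
  by_cases hgood : ∀ t ∈ σ, Branch (fun σ => F σ ∧ σ ≠ {r}) (rev t) (D t)
  · obtain rfl | hσr := eq_or_ne σ {r}
    · exact .inr ⟨D r, hD r rfl, by rwa [Set.biUnion_singleton] at hE⟩
    · exact .inl ⟨σ, ⟨hσ, hσr⟩, D, hgood, hE⟩
  · push Not at hgood
    obtain ⟨t, ht, hbad⟩ := hgood
    have hback := Branch.mk σ t D hσ ht fun x hx _ => hD x hx
    obtain ⟨E', hE', hsub⟩ := ((hD t ht).reroot (by rwa [rev_rev])).resolve_left hbad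
    exact .inr ⟨E', hE', hE.trans
      (symmClosure_subset_iff.2 ((biUnion_subset_union_insert σ D t).trans hsub))⟩

end Branch

section ShiftBranch

variable {U : Type*} [SubmodularUniverse U] {k : ℕ} {F F' : Set U → Prop} {E P Q σ : Set U}
  {p q s t u : U}

theorem IsStar.eq_of_inf_rev_eq (hσ : IsStar σ) (hσk : σ ⊆ Sk U k) (ht : t ∈ σ) (hu : u ∈ σ)
    (hQ : IsRegularProfile (Sk U k) Q) (hpQ : p ∈ Q) (huQ : rev u ∈ Q)
    (hk : u ⊓ rev p ∈ Sk U k) (htu : t ⊓ rev p = u ⊓ rev p) : t = u := by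
  have htQ : rev t ∈ Q := by
    refine hQ.mem_of_le (hQ.rev_inf_rev_mem huQ hpQ hk) (rev_mem_Sk (hσk ht)) ?_
    rw [← htu, rev_inf_rev]
    exact le_sup_left
  by_contra htu
  exact hQ.rev_notMem (hQ.mem_of_le huQ (hσk ht) (hσ t ht u hu htu)) htQ

theorem Branch.shift (hstar : ∀ σ, F σ → IsStar σ) (hsub : ∀ σ, F σ → σ ⊆ Sk U k)
    (hqp : Linked q p) (hF : ∀ σ, F σ → ∀ s ∈ σ, q ≤ s → F' (shiftStar σ s p))
    (h : Branch F s E) (hqs : q ≤ s) :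
    ∃ E', Branch F' (s ⊔ p) E' ∧
      ∀ e ∈ E, ∀ Q, IsRegularProfile (Sk U k) Q → p ∈ Q → e ∈ Q → e ⊔ p ∈ E' := by
  classical
  induction h with
  | mk σ s E hσ hs h ih =>
    have hst : ∀ t ∈ σ, t ≠ s → s ≤ rev t := fun t ht hts =>
      hstar σ hσ s hs t ht (Ne.symm hts)
    have hshift := shiftStar_subset_Sk hqp (hstar σ hσ) (hsub σ hσ) hs hqs
    choose! D hD hDE using fun t ht hts => ih t ht hts (hqs.trans (hst t ht hts))
    choose! c hc hcu using fun u (hu : u ∈ shiftStar σ s p) (hus : u ≠ s ⊔ p) =>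
      hu.resolve_left hus
    refine ⟨_, .mk (shiftStar σ s p) (s ⊔ p) (fun u => D (c u)) (hF σ hσ s hs hqs) (.inl rfl)
      fun u hu hus => ?_, ?_⟩
    · rw [← hcu u hu hus, rev_inf_rev, hcu u hu hus]
      exact hD _ (hc u hu hus).1 (hc u hu hus).2
    · rintro e (rfl | he) Q hQ hpQ heQ
      · exact .inl rfl
      obtain ⟨t, ⟨ht, hts⟩, he⟩ := Set.mem_iUnion₂.1 he
      have htQ : rev t ∈ Q :=
        hQ.mem_of_le heQ (rev_mem_Sk (hsub σ hσ ht)) ((h t ht hts).le hstar e he)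
      have hu : t ⊓ rev p ∈ shiftStar σ s p := .inr ⟨t, ⟨ht, hts⟩, rfl⟩
      have hus : t ⊓ rev p ≠ s ⊔ p := fun heq =>
        hQ.rev_notMem (hQ.sup_mem (hQ.mem_of_le htQ (hsub σ hσ hs) (hst t ht hts)) hpQ
          (hshift (.inl rfl))) (heq ▸ hQ.rev_inf_rev_mem htQ hpQ (hshift hu))
      have hct : c (t ⊓ rev p) = t := (hstar σ hσ).eq_of_inf_rev_eq (hsub σ hσ)
        (hc _ hu hus).1 ht hQ hpQ htQ (hshift hu) (hcu _ hu hus)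
      refine .inr (Set.mem_biUnion (x := t ⊓ rev p) ⟨hu, hus⟩ ?_)
      rw [hct]
      exact hDE t ht hts e he Q hQ hpQ heQ

end ShiftBranch

section Graph

open SimpleGraph

theorem isTree_sum_sup_edge {V W : Type*} [Finite V] [Finite W] {G : SimpleGraph V}
    {H : SimpleGraph W} (hG : G.IsTree) (hH : H.IsTree) (v : V) (w : W) :
    ((G ⊕g H) ⊔ edge (.inl v) (.inr w)).IsTree := by
  have hconn := Connected.sum_sup_edge (v := v) (w := w) hG.connected hH.connected
  rw [isTree_iff_connected_and_card] at hG hH ⊢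
  refine ⟨hconn, le_antisymm ?_ hconn.card_vert_le_card_edgeSet_add_one⟩
  have hsum : Nat.card (G ⊕g H).edgeSet = Nat.card G.edgeSet + Nat.card H.edgeSet := by
    rw [Nat.card_congr edgeSetSumEquiv, Nat.card_sum]
  have hunion : Nat.card ((G ⊕g H) ⊔ edge (.inl v) (.inr w)).edgeSet ≤
      Nat.card (G ⊕g H).edgeSet + 1 := by
    simp only [Nat.card_coe_set_eq, edgeSet_sup, edgeSet_edge_of_ne Sum.inl_ne_inr]
    rw [Set.union_singleton]
    exact Set.ncard_insert_le _ _
  rw [Nat.card_sum]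
  omega

end Graph

namespace STree

variable {U : Type*} [SeparationUniverse U] {S P : Set U} {T : STree S} {s u : U}

/-- The set of labels of the edges at `v`, oriented towards `v`. -/
def star (T : STree S) (v : T.V) : Set U :=
  {s | ∃ x, ∃ h : T.graph.Adj x v, T.label ⟨(x, v), h⟩ = s}

theorem label_mem_star (T : STree S) (e : T.graph.Dart) : T.label e ∈ T.star e.snd :=
  ⟨e.fst, e.adj, rfl⟩

theorem isSink_iff {v : T.V} : T.IsSink P v ↔ T.star v ⊆ P := by
  constructor
  · rintro h _ ⟨x, hx, rfl⟩
    exact h _ rfl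
  · rintro h e rfl
    exact h (T.label_mem_star e)

theorem degree_eq_encard_star (hT : T.Irredundant) (v : T.V) : T.degree v = (T.star v).encard := by
  refine Set.encard_congr (.ofBijective (fun x => ⟨T.label ⟨(x, v), x.2.symm⟩, x, x.2.symm, rfl⟩)
    ⟨fun x y hxy => ?_, ?_⟩)
  · by_contra hne
    exact hT ⟨(x, v), x.2.symm⟩ ⟨(y, v), y.2.symm⟩ rfl (fun h => hne (Subtype.ext h))
      (congrArg Subtype.val hxy)
  · rintro ⟨_, x, hx, rfl⟩
    exact ⟨⟨x, hx.symm⟩, rfl⟩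

theorem label_le_of_snd_eq_fst (hT : T.Irredundant) (hstar : ∀ v, IsStar (T.star v))
    {e f : T.graph.Dart} (hef : e.snd = f.fst) (hne : e.fst ≠ f.snd) : T.label e ≤ T.label f := by
  have hf : T.label f.symm ∈ T.star e.snd := hef ▸ T.label_mem_star f.symm
  have hle := hstar _ _ (T.label_mem_star e) _ hf (hT e f.symm hef hne)
  rwa [T.label_symm, rev_rev] at hle

theorem label_firstDart_le_label_lastDart (hT : T.Irredundant) (hstar : ∀ v, IsStar (T.star v))
    {v w : T.V} {p : T.graph.Walk v w} (hp : p.IsPath) (hnil : ¬ p.Nil) :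
    T.label (p.firstDart hnil) ≤ T.label (p.lastDart hnil) := by
  induction p with
  | nil => exact absurd .nil hnil
  | @cons x y _ h p ih =>
    cases p with
    | nil => exact le_rfl
    | @cons _ z _ h' q =>
      have hne : x ≠ z := by
        rintro rfl
        exact ((SimpleGraph.Walk.cons_isPath_iff _ _).1 hp).2 (by simp)
      have hlast : (SimpleGraph.Walk.cons h (.cons h' q)).lastDart hnil =
          (SimpleGraph.Walk.cons h' q).lastDart SimpleGraph.Walk.not_nil_cons :=
        SimpleGraph.Dart.ext _ _ (Prod.ext (SimpleGraph.Walk.penultimate_cons_cons _ _ _) rfl)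
      have hfirst : (SimpleGraph.Walk.cons h' q).firstDart SimpleGraph.Walk.not_nil_cons =
          ⟨(y, z), h'⟩ := SimpleGraph.Dart.ext _ _ (Prod.ext rfl (SimpleGraph.Walk.snd_cons _ _))
      have hrest := ih hp.of_cons SimpleGraph.Walk.not_nil_cons
      rw [hlast]
      rw [hfirst] at hrest
      exact (label_le_of_snd_eq_fst hT hstar (e := ⟨(x, y), h⟩) rfl hne).trans hrest

theorem orderRespecting_of_isStar (hT : T.Irredundant) (hstar : ∀ v, IsStar (T.star v)) :
    T.OrderRespecting := by
  rintro e f ⟨p, hp, he, hf⟩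
  have hnil : ¬ p.Nil := fun h => by
    rw [SimpleGraph.Walk.nil_iff_support_eq.1 h, List.mem_singleton] at he
    exact e.adj.ne' he
  have hfirst : p.firstDart hnil = e := SimpleGraph.Dart.ext _ _ <|
    Prod.ext rfl (T.isTree.isAcyclic.eq_snd_of_adj_start hp e.adj he).symm
  have hlast : p.lastDart hnil = f := SimpleGraph.Dart.ext _ _ <|
    Prod.ext (T.isTree.isAcyclic.eq_penultimate_of_adj_end hp f.adj.symm hf).symm rfl
  have hle := label_firstDart_le_label_lastDart hT hstar hp hnil
  rwa [hfirst, hlast] at hle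

theorem exists_isSink (T : STree S) (hP : ∀ s ∈ S, s ∈ P ∨ rev s ∈ P) : ∃ v, T.IsSink P v := by
  have := T.finite
  by_contra! hno
  have hout : ∀ v, ∃ e : T.graph.Dart, e.snd = v ∧ T.label e ∉ P := fun v => by
    simpa only [IsSink, not_forall, exists_prop] using hno v
  choose f hf hfP using hout
  -- The edges `f v` are distinct, so the tree has at least as many edges as nodes.
  have hinj : Function.Injective fun v => (⟨(f v).edge, (f v).edge_mem⟩ : T.graph.edgeSet) := by
    intro v w hvw
    obtain h | h := SimpleGraph.dart_edge_eq_iff _ _ |>.1 (Subtype.ext_iff.1 hvw)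
    · rw [← hf v, ← hf w, h]
    · have hrev := (hP _ (T.label_mem (f w))).resolve_left (hfP w)
      rw [← T.label_symm, ← h] at hrev
      exact absurd hrev (hfP v)
  have hcard : Nat.card T.V ≤ Nat.card T.graph.edgeSet :=
    Nat.card_le_card_of_injective _ hinj
  have hedges := (SimpleGraph.isTree_iff_connected_and_card.1 T.isTree).2
  omega

theorem IsSink.eq (hT : T.Irredundant) (hstar : ∀ v, IsStar (T.star v))
    (hP : IsRegularProfile S P) {v w : T.V} (hv : T.IsSink P v) (hw : T.IsSink P w) : w = v := by
  by_contra hne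
  obtain ⟨p, hp, -⟩ := T.isTree.existsUnique_path v w
  have hnil : ¬ p.Nil := SimpleGraph.Walk.not_nil_of_ne (Ne.symm hne)
  have hfirst : T.label (p.firstDart hnil) ∈ P := hP.mem_of_le (hw (p.lastDart hnil) rfl)
    (T.label_mem _) (label_firstDart_le_label_lastDart hT hstar hp hnil)
  refine hP.rev_notMem hfirst ?_
  rw [← T.label_symm]
  exact hv _ rfl

theorem exists_isNodeOf (hT : T.Irredundant) (hstar : ∀ v, IsStar (T.star v))
    (hP : IsRegularProfile S P) : ∃ v, T.IsNodeOf P v := by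
  obtain ⟨v, hv⟩ := T.exists_isSink fun s hs => hP.mem_or_rev_mem hs
  exact ⟨v, hv, fun w hw => hv.eq hT hstar hP hw⟩

/-- The tree with a single node. -/
def single (S : Set U) : STree S where
  V := Unit
  finite := inferInstance
  graph := ⊥
  isTree := .of_subsingleton
  label e := e.adj.elim
  label_mem e := e.adj.elim
  label_symm e := e.adj.elim

theorem star_single (v : (single S).V) : (single S).star v = ∅ :=
  Set.eq_empty_iff_forall_notMem.2 fun _ ⟨_, h, _⟩ => h

/-- The tree obtained from two disjoint trees by joining a node `w` of the second to a node `v` of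
the first by an edge labelled `u` towards `v`. -/
def join (T₁ T₂ : STree S) (v : T₁.V) (w : T₂.V) (hu : u ∈ S) (hu' : rev u ∈ S) : STree S where
  V := T₁.V ⊕ T₂.V
  finite := have := T₁.finite; have := T₂.finite; inferInstance
  graph := (T₁.graph ⊕g T₂.graph) ⊔ SimpleGraph.edge (.inl v) (.inr w)
  isTree := have := T₁.finite; have := T₂.finite; isTree_sum_sup_edge T₁.isTree T₂.isTree v w
  label
    | ⟨(.inl a, .inl b), h⟩ => T₁.label ⟨(a, b), by simpa [SimpleGraph.edge_adj] using h⟩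
    | ⟨(.inr a, .inr b), h⟩ => T₂.label ⟨(a, b), by simpa [SimpleGraph.edge_adj] using h⟩
    | ⟨(.inr _, .inl _), _⟩ => u
    | ⟨(.inl _, .inr _), _⟩ => rev u
  label_mem
    | ⟨(.inl _, .inl _), _⟩ => T₁.label_mem _
    | ⟨(.inr _, .inr _), _⟩ => T₂.label_mem _
    | ⟨(.inr _, .inl _), _⟩ => hu
    | ⟨(.inl _, .inr _), _⟩ => hu'
  label_symm
    | ⟨(.inl a, .inl b), h⟩ => T₁.label_symm ⟨(a, b), by simpa [SimpleGraph.edge_adj] using h⟩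
    | ⟨(.inr a, .inr b), h⟩ => T₂.label_symm ⟨(a, b), by simpa [SimpleGraph.edge_adj] using h⟩
    | ⟨(.inr _, .inl _), _⟩ => rfl
    | ⟨(.inl _, .inr _), _⟩ => (rev_rev u).symm

section Join

variable {T₁ T₂ : STree S} {v : T₁.V} {w : T₂.V} {hu : u ∈ S} {hu' : rev u ∈ S}

theorem join_adj_inl_inl {x y : T₁.V} :
    (join T₁ T₂ v w hu hu').graph.Adj (.inl x) (.inl y) ↔ T₁.graph.Adj x y := by
  simp [join, SimpleGraph.edge_adj]

theorem join_adj_inr_inr {x y : T₂.V} :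
    (join T₁ T₂ v w hu hu').graph.Adj (.inr x) (.inr y) ↔ T₂.graph.Adj x y := by
  simp [join, SimpleGraph.edge_adj]

theorem join_adj_inl_inr {x : T₁.V} {y : T₂.V} :
    (join T₁ T₂ v w hu hu').graph.Adj (.inl x) (.inr y) ↔ x = v ∧ y = w := by
  simp [join, SimpleGraph.edge_adj]

theorem star_join_inl (x : T₁.V) :
    (join T₁ T₂ v w hu hu').star (.inl x) = T₁.star x ∪ {s | x = v ∧ s = u} := by
  ext s
  constructor
  · rintro ⟨y | y, h, rfl⟩
    · exact .inl ⟨y, join_adj_inl_inl.1 h, rfl⟩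
    · exact .inr ⟨(join_adj_inl_inr.1 h.symm).1, rfl⟩
  · rintro (⟨y, h, rfl⟩ | ⟨rfl, rfl⟩)
    · exact ⟨.inl y, join_adj_inl_inl.2 h, rfl⟩
    · exact ⟨.inr w, (join_adj_inl_inr.2 ⟨rfl, rfl⟩).symm, rfl⟩

theorem star_join_inr (y : T₂.V) :
    (join T₁ T₂ v w hu hu').star (.inr y) = T₂.star y ∪ {s | y = w ∧ s = rev u} := by
  ext s
  constructor
  · rintro ⟨x | x, h, rfl⟩
    · exact .inr ⟨(join_adj_inl_inr.1 h).2, rfl⟩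
    · exact .inl ⟨x, join_adj_inr_inr.1 h, rfl⟩
  · rintro (⟨x, h, rfl⟩ | ⟨rfl, rfl⟩)
    · exact ⟨.inr x, join_adj_inr_inr.2 h, rfl⟩
    · exact ⟨.inl v, join_adj_inl_inr.2 ⟨rfl, rfl⟩, rfl⟩

theorem star_join_inl_self :
    (join T₁ T₂ v w hu hu').star (.inl v) = insert u (T₁.star v) := by
  ext s
  simp [star_join_inl]

theorem star_join_inr_self :
    (join T₁ T₂ v w hu hu').star (.inr w) = insert (rev u) (T₂.star w) := by
  ext s
  simp [star_join_inr]

theorem star_join_inl_of_ne {x : T₁.V} (hx : x ≠ v) :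
    (join T₁ T₂ v w hu hu').star (.inl x) = T₁.star x := by
  simp [star_join_inl, hx]

theorem star_join_inr_of_ne {y : T₂.V} (hy : y ≠ w) :
    (join T₁ T₂ v w hu hu').star (.inr y) = T₂.star y := by
  simp [star_join_inr, hy]

theorem Irredundant.join (h₁ : T₁.Irredundant) (h₂ : T₂.Irredundant) (hv : u ∉ T₁.star v)
    (hw : rev u ∉ T₂.star w) : (STree.join T₁ T₂ v w hu hu').Irredundant := by
  rintro ⟨⟨a | a, c⟩, ha⟩ ⟨⟨b | b, d⟩, hb⟩ (rfl : c = d) hab heq <;> obtain c | c := c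
  · exact h₁ ⟨(a, c), join_adj_inl_inl.1 ha⟩ ⟨(b, c), join_adj_inl_inl.1 hb⟩ rfl
      (fun h => hab (congrArg Sum.inl h)) heq
  · exact hab (congrArg Sum.inl
      ((join_adj_inl_inr.1 ha).1.trans (join_adj_inl_inr.1 hb).1.symm))
  · obtain ⟨rfl, rfl⟩ := join_adj_inl_inr.1 hb.symm
    exact hv ⟨a, join_adj_inl_inl.1 ha, heq⟩
  · obtain ⟨rfl, rfl⟩ := join_adj_inl_inr.1 ha
    exact hw ⟨b, join_adj_inr_inr.1 hb, heq.symm⟩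
  · obtain ⟨rfl, rfl⟩ := join_adj_inl_inr.1 ha.symm
    exact hv ⟨b, join_adj_inl_inl.1 hb, heq.symm⟩
  · obtain ⟨rfl, rfl⟩ := join_adj_inl_inr.1 hb
    exact hw ⟨a, join_adj_inr_inr.1 ha, heq⟩
  · exact hab (congrArg Sum.inr
      ((join_adj_inl_inr.1 ha.symm).2.trans (join_adj_inl_inr.1 hb.symm).2.symm))
  · exact h₂ ⟨(a, c), join_adj_inr_inr.1 ha⟩ ⟨(b, c), join_adj_inr_inr.1 hb⟩ rfl
      (fun h => hab (congrArg Sum.inr h)) heq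

end Join

end STree

section RootedTree

variable {U : Type*} [SeparationUniverse U] {S P : Set U} {F : Set U → Prop} {D E σ τ : Set U}
  {s u : U}

/-- There is an irredundant `S`-tree with a root carrying the star `σ`, whose other nodes carry
stars satisfying `F`, such that all elements of `E` are labels of it. -/
def HasRootedTree (S : Set U) (F : Set U → Prop) (σ E : Set U) : Prop :=
  ∃ T : STree S, T.Irredundant ∧ ∃ v, T.star v = σ ∧ (∀ w ≠ v, F (T.star w)) ∧
    E ⊆ Set.range T.label

theorem HasRootedTree.mono (h : HasRootedTree S F σ E) (hDE : D ⊆ E) : HasRootedTree S F σ D := by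
  obtain ⟨T, hT, v, hσ, hF, hE⟩ := h
  exact ⟨T, hT, v, hσ, hF, hDE.trans hE⟩

theorem hasRootedTree_empty : HasRootedTree S F ∅ ∅ :=
  ⟨.single S, fun e => e.adj.elim, (), STree.star_single _, fun _ hw => absurd rfl hw,
    Set.empty_subset _⟩

theorem HasRootedTree.join (h₁ : HasRootedTree S F σ E) (h₂ : HasRootedTree S F τ D) (hu : u ∈ S)
    (hu' : rev u ∈ S) (hσ : u ∉ σ) (hτ : rev u ∉ τ) (hF : F (insert (rev u) τ)) :
    HasRootedTree S F (insert u σ) (insert (rev u) (E ∪ D)) := by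
  obtain ⟨T₁, hT₁, v, rfl, hF₁, hE⟩ := h₁
  obtain ⟨T₂, hT₂, w, rfl, hF₂, hD⟩ := h₂
  refine ⟨T₁.join T₂ v w hu hu', hT₁.join hT₂ hσ hτ, .inl v, STree.star_join_inl_self, ?_, ?_⟩
  · rintro (x | y) hne
    · have hx : x ≠ v := fun h => hne (congrArg Sum.inl h)
      rw [STree.star_join_inl_of_ne hx]
      exact hF₁ x hx
    · obtain rfl | hy := eq_or_ne y w
      · rwa [STree.star_join_inr_self]
      · rw [STree.star_join_inr_of_ne hy]
        exact hF₂ y hy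
  · rintro e (rfl | he | he)
    · exact ⟨⟨(.inl v, .inr w), STree.join_adj_inl_inr.2 ⟨rfl, rfl⟩⟩, rfl⟩
    · obtain ⟨⟨⟨a, b⟩, h⟩, rfl⟩ := hE he
      exact ⟨⟨(.inl a, .inl b), STree.join_adj_inl_inl.2 h⟩, rfl⟩
    · obtain ⟨⟨⟨a, b⟩, h⟩, rfl⟩ := hD he
      exact ⟨⟨(.inr a, .inr b), STree.join_adj_inr_inr.2 h⟩, rfl⟩

theorem HasRootedTree.of_children (hσ : σ.Finite) (hS : ∀ s ∈ S, rev s ∈ S) (hσS : σ ⊆ S)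
    {D : U → Set U}
    (h : ∀ t ∈ σ, ∃ τ, F τ ∧ rev t ∈ τ ∧ HasRootedTree S F (τ \ {rev t}) (D t \ {rev t})) :
    HasRootedTree S F σ (⋃ t ∈ σ, D t) := by
  induction σ, hσ using Set.Finite.induction_on with
  | empty => simpa only [Set.biUnion_empty] using hasRootedTree_empty
  | @insert u σ hu _ ih =>
    obtain ⟨τ, hτ, huτ, hT⟩ := h u (.inl rfl)
    have huS := hσS (.inl rfl)
    have hrest := ih (fun t ht => hσS (.inr ht)) fun t ht => h t (.inr ht)
    refine (hrest.join hT huS (hS u huS) hu (fun h => h.2 rfl)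
      (by rwa [Set.insert_sdiff_self_of_mem huτ])).mono ?_
    rw [Set.biUnion_insert, Set.union_comm, ← Set.union_insert, Set.insert_sdiff_singleton]
    exact Set.union_subset_union_right _ (Set.subset_insert _ _)

theorem Branch.hasRootedTree [Finite U] (hS : ∀ s ∈ S, rev s ∈ S) (hF : ∀ σ, F σ → σ ⊆ S)
    (h : Branch F s E) : ∃ σ, F σ ∧ s ∈ σ ∧ HasRootedTree S F (σ \ {s}) (E \ {s}) := by
  induction h with
  | mk σ s E hσ hs _ ih =>
    refine ⟨σ, hσ, hs, (HasRootedTree.of_children (D := E) (Set.toFinite _) hS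
      (Set.sdiff_subset.trans (hF σ hσ)) fun t ht => ih t ht.1 ht.2).mono ?_⟩
    exact fun e he => he.1.resolve_left he.2

theorem TreeOver.exists_sTree [Finite U] (hS : ∀ s ∈ S, rev s ∈ S) (hF : ∀ σ, F σ → σ ⊆ S)
    (h : TreeOver F E) :
    ∃ T : STree S, T.Irredundant ∧ (∀ v, F (T.star v)) ∧ E ⊆ Set.range T.label := by
  obtain ⟨σ, hσ, D, hD, hE⟩ := h
  obtain ⟨T, hT, v, hv, hw, hlabel⟩ := HasRootedTree.of_children (Set.toFinite σ) hS (hF σ hσ)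
    fun t ht => (hD t ht).hasRootedTree hS hF
  refine ⟨T, hT, fun w => ?_, fun e he => ?_⟩
  · obtain rfl | hne := eq_or_ne w v
    · rwa [hv]
    · exact hw w hne
  · obtain he | he := hE he
    · exact hlabel he
    · obtain ⟨d, hd⟩ := hlabel he
      exact ⟨d.symm, by rw [T.label_symm, hd, rev_rev]⟩

theorem TreeOver.exists_subset [Finite U] (hS : ∀ s ∈ S, rev s ∈ S) (hF : ∀ σ, F σ → σ ⊆ S)
    (h : TreeOver F E) (hP : ∀ s ∈ S, s ∈ P ∨ rev s ∈ P) : ∃ σ, F σ ∧ σ ⊆ P := by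
  obtain ⟨T, -, hT, -⟩ := h.exists_sTree hS hF
  obtain ⟨v, hv⟩ := T.exists_isSink hP
  exact ⟨_, hT v, STree.isSink_iff.1 hv⟩

end RootedTree

section UpClosed

/-- `A` is an up-closed subset of `S`. -/
def UpClosedIn {α : Type*} [LE α] (S A : Set α) : Prop := A ⊆ S ∧ ∀ a ∈ A, ∀ b ∈ S, a ≤ b → b ∈ A

theorem UpClosedIn.insert {α : Type*} [PartialOrder α] {S A : Set α} {r : α} (hA : UpClosedIn S A)
    (hr : Maximal (· ∈ S \ A) r) : UpClosedIn S (insert r A) := by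
  refine ⟨Set.insert_subset hr.1.1 hA.1, ?_⟩
  rintro a (rfl | ha) b hb hab
  · by_cases hbA : b ∈ A
    · exact .inr hbA
    · exact .inl (hr.eq_of_le ⟨hb, hbA⟩ hab).symm
  · exact .inr (hA.2 a ha b hb hab)

end UpClosed

section NodeStar

variable {U : Type*} [SubmodularUniverse U] {k : ℕ} {A P σ : Set U} {p r s t : U}

/-- `σ` is an efficient star for `P` of the least possible size. -/
def IsOptimalStarFor (k : ℕ) (P σ : Set U) : Prop :=
  IsEffStarFor k P σ ∧ σ.encard = deltaE k P

theorem IsOptimalStarFor.shiftStar (hσ : IsOptimalStarFor k P σ)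
    (hP : IsRegularProfile (Sk U k) P) (hpP : p ∈ P) (hqp : Linked r p) (hs : s ∈ σ)
    (hrs : r ≤ s) : IsOptimalStarFor k P (shiftStar σ s p) := by
  have heff := hσ.1.shiftStar hP hpP hqp hs hrs
  exact ⟨heff, le_antisymm ((encard_shiftStar_le hs p).trans hσ.2.le) (iInf₂_le _ heff)⟩

/-- The stars allowed at the nodes of a tree when the elements of `A` are forbidden: stars of
bounded size that lie in no regular profile, optimal stars for the regular profiles that avoid `A`,
and singletons in `A`. The last kind marks the places where the tree still has to be extended. -/
inductive IsNodeStar (k : ℕ) (A : Set U) : Set U → Prop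
  | void (σ : Set U) (hσk : σ ⊆ Sk U k) (hσ : IsStar σ)
      (hvoid : ∀ P, IsRegularProfile (Sk U k) P → ¬ σ ⊆ P)
      (hcard : σ.encard ≤ max (deltaEMax U k) 3) : IsNodeStar k A σ
  | optimal (P σ : Set U) (hP : IsRegularProfile (Sk U k) P) (hAP : Disjoint A P)
      (hσ : IsOptimalStarFor k P σ) : IsNodeStar k A σ
  | leaf (a : U) (hak : a ∈ Sk U k) (ha : a ∈ A) : IsNodeStar k A {a}

namespace IsNodeStar

theorem isStar (h : IsNodeStar k A σ) : IsStar σ := by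
  cases h with
  | void _ _ hσ => exact hσ
  | optimal _ _ _ _ hσ => exact hσ.1.2.1
  | leaf a => exact isStar_singleton a

theorem subset (h : IsNodeStar k A σ) : σ ⊆ Sk U k := by
  cases h with
  | void _ hσk => exact hσk
  | optimal _ _ hP _ hσ => exact hσ.1.1.trans hP.subset
  | leaf a hak => exact Set.singleton_subset_iff.2 hak

theorem singleton_of_cosmall (hs : s ∈ Sk U k) (hcosmall : Cosmall s) : IsNodeStar k A {s} := by
  refine .void _ (Set.singleton_subset_iff.2 hs) (isStar_singleton s)
    (fun P hP hsP => hP.not_cosmall (hsP rfl) hcosmall) (le_max_of_le_right ?_)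
  rw [Set.encard_singleton]
  norm_num

theorem of_insert (h : IsNodeStar k (insert r A) σ) (hσ : σ ≠ {r}) : IsNodeStar k A σ := by
  cases h with
  | void _ hσk hstar hvoid hcard => exact .void σ hσk hstar hvoid hcard
  | optimal P _ hP hAP hopt =>
    exact .optimal P σ hP (hAP.mono_left (Set.subset_insert _ _)) hopt
  | leaf a hak ha => exact .leaf a hak (ha.resolve_left fun har => hσ (by rw [har]))

theorem eq_singleton_or_of_subset (h : IsNodeStar k A σ) (hP : IsRegularProfile (Sk U k) P)
    (hσP : σ ⊆ P) : (∃ a ∈ A, σ = {a}) ∨ Disjoint A P ∧ IsOptimalStarFor k P σ := by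
  cases h with
  | void _ _ _ hvoid => exact absurd hσP (hvoid P hP)
  | optimal P' _ _ hAP hσ =>
    obtain rfl := (isEffStarFor_iff.1 hσ.1).1.eq_of_subset hP hσP
    exact .inr ⟨hAP, hσ⟩
  | leaf a _ ha => exact .inl ⟨a, ha, rfl⟩

theorem encard_le (h : IsNodeStar k ∅ σ) : σ.encard ≤ max (deltaEMax U k) 3 := by
  cases h with
  | void _ _ _ _ hcard => exact hcard
  | optimal P _ hP _ hσ => exact hσ.2.le.trans (le_max_of_le_left (deltaE_le_deltaEMax hP))
  | leaf a _ ha => exact ha.elim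

end IsNodeStar

theorem IsNodeStar.shiftStar (hA : UpClosedIn (Sk U k) A) (hp : p ∈ Sk U k)
    (hrp : Linked (rev r) p) (h : IsNodeStar k (insert r A) σ) (hs : s ∈ σ) (hrs : rev r ≤ s) :
    IsNodeStar k A (shiftStar σ s p) := by
  have hk := shiftStar_subset_Sk hrp h.isStar h.subset hs hrs
  have hstar := h.isStar.shiftStar hs p
  have hsubset : ∀ Q, IsRegularProfile (Sk U k) Q → SepSys.shiftStar σ s p ⊆ Q → σ ⊆ Q :=
    fun Q hQ => subset_of_shiftStar_subset hp h.subset hQ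
  cases h with
  | void _ _ _ hvoid hcard =>
    exact .void _ hk hstar (fun Q hQ hσQ => hvoid Q hQ (hsubset Q hQ hσQ))
      ((encard_shiftStar_le hs p).trans hcard)
  | optimal P _ hP hAP hσ =>
    by_cases hpP : p ∈ P
    · exact .optimal P _ hP (hAP.mono_left (Set.subset_insert _ _))
        (hσ.shiftStar hP hpP hrp hs hrs)
    · refine .void _ hk hstar (fun Q hQ hσQ => hpP ?_) ((encard_shiftStar_le hs p).trans
        (hσ.2.le.trans (le_max_of_le_left (deltaE_le_deltaEMax hP))))
      obtain rfl := (isEffStarFor_iff.1 hσ.1).1.eq_of_subset hQ (hsubset Q hQ hσQ)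
      exact mem_of_shiftStar_subset hp hQ hσQ
  | leaf a _ ha =>
    obtain rfl : s = a := hs
    rw [shiftStar_singleton] at hk ⊢
    obtain rfl | ha := ha
    · exact singleton_of_cosmall (hk rfl) ((rev_antitone le_sup_left).trans (hrs.trans le_sup_left))
    · exact .leaf _ (hk rfl) (hA.2 s ha _ (hk rfl) le_sup_left)

end NodeStar

section AvoidingTree

variable {U : Type*} [SubmodularUniverse U] {k : ℕ} {A E E' P Q : Set U} {p r s t : U}

/-- The regular profiles of `Sk U k` that contain no element of `A`. -/
def profilesAvoiding (k : ℕ) (A : Set U) : Set (Set U) :=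
  {P | IsRegularProfile (Sk U k) P ∧ Disjoint A P}

/-- Any two distinct members of `𝓟` are efficiently distinguished by an element of `E`. -/
def EffSeparates (E : Set U) (𝓟 : Set (Set U)) : Prop :=
  𝓟.Pairwise fun P Q => ∃ e ∈ E, EffDistinguishes e P Q

/-- Some finite tree whose nodes carry node stars relative to `A` efficiently distinguishes all
regular profiles that avoid `A`. -/
def HasEffTree (k : ℕ) (A : Set U) : Prop :=
  ∃ E, TreeOver (IsNodeStar k A) E ∧ EffSeparates E (profilesAvoiding k A)

theorem EffSeparates.of_subset_symmClosure {𝓟 : Set (Set U)} (h : EffSeparates E 𝓟)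
    (hE : E ⊆ symmClosure E') : EffSeparates E' 𝓟 := by
  intro P hP Q hQ hPQ
  obtain ⟨e, he, heff⟩ := h hP hQ hPQ
  obtain he' | he' := hE he
  · exact ⟨e, he', heff⟩
  · exact ⟨rev e, he', effDistinguishes_rev_iff.2 heff⟩

theorem mem_profilesAvoiding_insert [Finite U]
    (hT : TreeOver (fun σ => IsNodeStar k (insert r A) σ ∧ σ ≠ {r}) E)
    (hP : P ∈ profilesAvoiding k A) : P ∈ profilesAvoiding k (insert r A) := by
  obtain ⟨σ, ⟨hσ, hσr⟩, hσP⟩ := hT.exists_subset (fun s hs => rev_mem_Sk hs)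
    (fun σ hσ => hσ.1.subset) fun s hs => hP.1.mem_or_rev_mem hs
  obtain ⟨a, rfl | ha, rfl⟩ | ⟨hAP, -⟩ := hσ.eq_singleton_or_of_subset hP.1 hσP
  · exact absurd rfl hσr
  · exact absurd (hσP rfl) (hP.2.notMem_of_mem_left ha)
  · exact ⟨hP.1, hAP⟩

theorem Branch.exists_effSeparates (hA : UpClosedIn (Sk U k) A) (hr : r ∈ Sk U k)
    (hp : p ∈ Sk U k) (hrp : Linked (rev r) p)
    (hB : Branch (IsNodeStar k (insert r A)) (rev r) E)
    (hE : EffSeparates E (profilesAvoiding k (insert r A))) :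
    ∃ D, Branch (IsNodeStar k A) p D ∧ EffSeparates D {P ∈ profilesAvoiding k A | p ∈ P} := by
  obtain ⟨D, hD, hDE⟩ := hB.shift (fun σ hσ => hσ.isStar) (fun σ hσ => hσ.subset) hrp
    (fun σ hσ s hs hrs => hσ.shiftStar hA hp hrp hs hrs) le_rfl
  rw [sup_eq_right.2 hrp.1] at hD
  have havoid : ∀ P ∈ profilesAvoiding k A, p ∈ P → P ∈ profilesAvoiding k (insert r A) := by
    refine fun P hP hpP => ⟨hP.1, Set.disjoint_insert_left.2 ⟨fun hrP => ?_, hP.2⟩⟩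
    exact hP.1.rev_notMem hrP (hP.1.mem_of_le hpP (rev_mem_Sk hr) hrp.1)
  have hsup : ∀ P Q, IsRegularProfile (Sk U k) P → IsRegularProfile (Sk U k) Q → p ∈ P →
      ∀ e ∈ E, EffDistinguishes e P Q → e ∈ P → rev e ∈ Q → ∃ d ∈ D, EffDistinguishes d P Q :=
    fun P Q hP hQ hpP e he heff heP heQ => ⟨e ⊔ p, hDE e he P hP hpP heP,
      heff.sup hP hQ heP heQ hpP (hrp.2 e (hB.le (fun σ hσ => hσ.isStar) e he))⟩
  refine ⟨D, hD, fun P ⟨hP, hpP⟩ Q ⟨hQ, hpQ⟩ hPQ => ?_⟩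
  obtain ⟨e, he, heff⟩ := hE (havoid P hP hpP) (havoid Q hQ hpQ) hPQ
  obtain ⟨heP, heQ⟩ | ⟨heP, heQ⟩ := heff.1
  · exact hsup P Q hP.1 hQ.1 hpP e he heff heP heQ
  · simp only [effDistinguishes_comm (P := P)] at heff ⊢
    exact hsup Q P hQ.1 hP.1 hpQ e he heff heQ heP

theorem HasEffTree.of_insert_or_exists_branch [Finite U] (h : HasEffTree k (insert r A))
    (hA : UpClosedIn (Sk U k) A) (hr : r ∈ Sk U k) (hp : p ∈ Sk U k) (hrp : Linked (rev r) p) :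
    HasEffTree k A ∨
      ∃ D, Branch (IsNodeStar k A) p D ∧ EffSeparates D {P ∈ profilesAvoiding k A | p ∈ P} := by
  obtain ⟨E, hT, hE⟩ := h
  obtain hT' | ⟨E', hB, hEE'⟩ := hT.reroot (r := r)
  · exact .inl ⟨E, hT'.mono fun σ hσ => hσ.1.of_insert hσ.2,
      hE.mono fun P hP => mem_profilesAvoiding_insert hT' hP⟩
  · exact .inr (hB.exists_effSeparates hA hr hp hrp (hE.of_subset_symmClosure hEE'))

end AvoidingTree

section CornerStar

variable {U : Type*} [SeparationUniverse U]

/-- The three-element star with which profiles are characterised: a regular profile that contains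
`s` and one of the corners `r ⊓ rev s`, `rev r ⊓ rev s` does not contain the other. -/
def cornerStar (r s : U) : Set U := {r ⊓ rev s, s, rev r ⊓ rev s}

theorem isStar_cornerStar (r s : U) : IsStar (cornerStar r s) := by
  have hr : r ⊓ rev s ≤ rev s := inf_le_right
  have hr' : rev r ⊓ rev s ≤ rev s := inf_le_right
  have hrr : r ⊓ rev s ≤ rev (rev r ⊓ rev s) := by
    rw [rev_inf_rev, rev_rev]
    exact inf_le_left.trans le_sup_left
  rintro x (rfl | rfl | rfl) y (rfl | rfl | rfl) hxy
  exacts [absurd rfl hxy, hr, hrr, le_rev_iff.1 hr, absurd rfl hxy, le_rev_iff.1 hr',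
    le_rev_iff.1 hrr, hr', absurd rfl hxy]

theorem encard_cornerStar_le (r s : U) : (cornerStar r s).encard ≤ 3 :=
  calc (cornerStar r s).encard ≤ ({s, rev r ⊓ rev s} : Set U).encard + 1 :=
        Set.encard_insert_le _ _
    _ ≤ ({rev r ⊓ rev s} : Set U).encard + 1 + 1 := by
        gcongr
        exact Set.encard_insert_le _ _
    _ = 3 := by rw [Set.encard_singleton]; norm_num

end CornerStar

section Decided

variable {U : Type*} [SubmodularUniverse U] {k : ℕ} {A P : Set U} {r s : U}

theorem IsRegularProfile.not_cornerStar_subset (hP : IsRegularProfile (Sk U k) P)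
    (hr : r ∈ Sk U k) : ¬ cornerStar r s ⊆ P := by
  intro hsub
  have hrs : r ⊓ rev s ∈ P := hsub (.inl rfl)
  have hs : s ∈ P := hsub (.inr (.inl rfl))
  by_cases hrP : r ∈ P
  · exact hP.1.2.2 r hrP s hs (hsub (.inr (.inr rfl)))
  · exact hP.rev_notMem hrs (hP.rev_inf_rev_mem (hP.rev_mem hr hrP) hs (hP.subset hrs))

theorem isOrientation_sdiff (hdec : ∀ s ∈ Sk U k, s ∈ A ∨ rev s ∈ A)
    (hanti : ∀ s ∈ A, rev s ∉ A) : IsOrientation (Sk U k) (Sk U k \ A) := by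
  refine ⟨Set.sdiff_subset, fun s hs => ?_, fun s hs => ?_⟩
  · rw [Set.encard_le_one_iff]
    have := hdec s hs
    rintro a b ⟨ha, rfl | rfl⟩ ⟨hb, rfl | rfl⟩ <;> grind
  · obtain hsA | hsA := hdec s hs
    · exact .inr ⟨rev_mem_Sk hs, hanti s hsA⟩
    · exact .inl ⟨hs, fun h => hanti s h hsA⟩

theorem UpClosedIn.consistent_sdiff (hA : UpClosedIn (Sk U k) A)
    (hdec : ∀ s ∈ Sk U k, s ∈ A ∨ rev s ∈ A) : Consistent (Sk U k \ A) := by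
  rintro ⟨r, hr, s, hs, hle, -⟩
  exact hs.2 (hA.2 _ ((hdec r hr.1).resolve_left hr.2) s hs.1 hle)

theorem UpClosedIn.inf_rev_notMem_sdiff (hA : UpClosedIn (Sk U k) A)
    (hvoid : ∀ σ ⊆ Sk U k \ A, ¬ IsNodeStar k A σ) (hr : r ∈ Sk U k \ A) (hs : s ∈ Sk U k \ A) :
    rev r ⊓ rev s ∉ Sk U k \ A := by
  have key : ∀ r ∈ Sk U k \ A, ∀ s ∈ Sk U k \ A, order (r ⊓ rev s) ≤ order r →
      rev r ⊓ rev s ∉ Sk U k \ A := by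
    intro r hr s hs hle hcorner
    have hrs : r ⊓ rev s ∈ Sk U k \ A := by
      have hk := mem_Sk_of_order_le hle hr.1
      exact ⟨hk, fun h => hr.2 (hA.2 _ h r hr.1 inf_le_left)⟩
    have hsub : cornerStar r s ⊆ Sk U k \ A := by
      rintro x (rfl | rfl | rfl)
      exacts [hrs, hs, hcorner]
    exact hvoid _ hsub (.void _ (hsub.trans Set.sdiff_subset) (isStar_cornerStar r s)
      (fun P hP => hP.not_cornerStar_subset hr.1)
      (le_max_of_le_right (encard_cornerStar_le r s)))
  obtain h | h := order_inf_rev_le_or r s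
  · exact key r hr s hs h
  · rw [inf_comm]
    exact key s hs r hr h

theorem UpClosedIn.isRegularProfile_sdiff (hA : UpClosedIn (Sk U k) A)
    (hdec : ∀ s ∈ Sk U k, s ∈ A ∨ rev s ∈ A) (hanti : ∀ s ∈ A, rev s ∉ A)
    (hvoid : ∀ σ ⊆ Sk U k \ A, ¬ IsNodeStar k A σ) : IsRegularProfile (Sk U k) (Sk U k \ A) :=
  ⟨⟨isOrientation_sdiff hdec hanti, hA.consistent_sdiff hdec,
    fun _ hr _ hs => hA.inf_rev_notMem_sdiff hvoid hr hs⟩,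
    fun s hs hcosmall => hvoid {s} (Set.singleton_subset_iff.2 hs)
      (.singleton_of_cosmall hs.1 hcosmall)⟩

theorem UpClosedIn.exists_isNodeStar_subset_sdiff [Finite U] (hA : UpClosedIn (Sk U k) A)
    (hdec : ∀ s ∈ Sk U k, s ∈ A ∨ rev s ∈ A) (hanti : ∀ s ∈ A, rev s ∉ A) :
    ∃ σ ⊆ Sk U k \ A, IsNodeStar k A σ := by
  by_contra! hvoid
  have hP := hA.isRegularProfile_sdiff hdec hanti hvoid
  obtain ⟨σ, hσ⟩ := exists_isEffStarFor_encard_eq hP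
  exact hvoid σ hσ.1.1 (.optimal _ σ hP Set.disjoint_sdiff_right hσ)

theorem UpClosedIn.exists_treeOver [Finite U] (hA : UpClosedIn (Sk U k) A)
    (hdec : ∀ s ∈ Sk U k, s ∈ A ∨ rev s ∈ A) : ∃ E, TreeOver (IsNodeStar k A) E := by
  have hleaf : ∀ a ∈ A, Branch (IsNodeStar k A) a {a} := fun a ha =>
    .leaf (.leaf a (hA.1 ha) ha)
  by_cases hanti : ∀ s ∈ A, rev s ∉ A
  · obtain ⟨σ, hσA, hσ⟩ := hA.exists_isNodeStar_subset_sdiff hdec hanti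
    exact ⟨∅, σ, hσ, fun t => {rev t}, fun t ht =>
      hleaf _ ((hdec t (hσA ht).1).resolve_left (hσA ht).2), Set.empty_subset _⟩
  · push Not at hanti
    obtain ⟨s, hs, hs'⟩ := hanti
    exact ⟨_, (hleaf s hs).glue (hleaf _ hs')⟩

theorem UpClosedIn.hasEffTree_of_decided [Finite U] (hA : UpClosedIn (Sk U k) A)
    (hdec : ∀ s ∈ Sk U k, s ∈ A ∨ rev s ∈ A) : HasEffTree k A := by
  obtain ⟨E, hE⟩ := hA.exists_treeOver hdec
  refine ⟨E, hE, fun P ⟨hP, hAP⟩ Q ⟨hQ, hAQ⟩ hPQ => ?_⟩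
  obtain ⟨s, hsP, hsQ⟩ := hP.exists_mem_rev_mem_of_ne hQ hPQ.symm
  obtain hsA | hsA := hdec s (hP.subset hsP)
  · exact absurd hsP (hAP.notMem_of_mem_left hsA)
  · exact absurd hsQ (hAQ.notMem_of_mem_left hsA)

end Decided

section Undecided

variable {U : Type*} [SubmodularUniverse U] {k : ℕ} {A D E P Q : Set U} {r s t : U}

/-- The separations of which neither orientation is forbidden. -/
def undecided (k : ℕ) (A : Set U) : Set U := {s ∈ Sk U k | s ∉ A ∧ rev s ∉ A}

theorem rev_mem_undecided (ht : t ∈ undecided k A) : rev t ∈ undecided k A :=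
  ⟨rev_mem_Sk ht.1, ht.2.2, by rw [rev_rev]; exact ht.2.1⟩

theorem order_le_of_minimalFor_undecided (ht : MinimalFor (· ∈ undecided k A) order t)
    (hs : s ∉ A) (hs' : rev s ∉ A) : order t ≤ order s := by
  by_cases hsk : s ∈ Sk U k
  · exact (le_total (order t) (order s)).elim id (ht.2 ⟨hsk, hs, hs'⟩)
  · exact (Nat.le_of_lt ht.1.1).trans (not_lt.1 hsk)

theorem minimalFor_undecided_rev (ht : MinimalFor (· ∈ undecided k A) order t) :
    MinimalFor (· ∈ undecided k A) order (rev t) := by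
  refine ⟨rev_mem_undecided ht.1, fun s hs _ => ?_⟩
  rw [order_rev]
  exact order_le_of_minimalFor_undecided ht hs.2.1 hs.2.2

theorem linked_of_minimalFor_undecided (hA : UpClosedIn (Sk U k) A)
    (ht : MinimalFor (· ∈ undecided k A) order t) (hr : r ∈ Sk U k \ A) (htr : rev t ≤ r) :
    Linked (rev r) t := by
  refine linked_of_forall_order_le (rev_le_iff.1 htr) fun x hrx hxt => ?_
  exact order_le_of_minimalFor_undecided ht (fun h => ht.1.2.1 (hA.2 x h t ht.1.1 hxt))
    fun h => hr.2 (hA.2 _ h r hr.1 (rev_le_iff.1 hrx))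

theorem effDistinguishes_of_minimalFor_undecided (ht : MinimalFor (· ∈ undecided k A) order t)
    (hP : P ∈ profilesAvoiding k A) (hQ : Q ∈ profilesAvoiding k A) (htPQ : Distinguishes t P Q) :
    EffDistinguishes t P Q := by
  refine ⟨htPQ, fun ⟨x, hxt, hx⟩ => hxt.not_ge ?_⟩
  have hnotMem : ∀ a ∈ A, a ∉ P ∧ a ∉ Q := fun a ha =>
    ⟨hP.2.notMem_of_mem_left ha, hQ.2.notMem_of_mem_left ha⟩
  refine order_le_of_minimalFor_undecided ht (fun h => ?_) fun h => ?_
  · exact hx.elim (fun hx => (hnotMem x h).1 hx.1) fun hx => (hnotMem x h).2 hx.2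
  · exact hx.elim (fun hx => (hnotMem _ h).2 hx.2) fun hx => (hnotMem _ h).1 hx.1

theorem hasEffTree_of_branches (ht : MinimalFor (· ∈ undecided k A) order t)
    (hB : Branch (IsNodeStar k A) t E) (hE : EffSeparates E {P ∈ profilesAvoiding k A | t ∈ P})
    (hB' : Branch (IsNodeStar k A) (rev t) D)
    (hD : EffSeparates D {P ∈ profilesAvoiding k A | rev t ∈ P}) : HasEffTree k A := by
  refine ⟨E ∪ D, hB.glue hB', fun P hP Q hQ hPQ => ?_⟩
  have hdist : Distinguishes t P Q → ∃ e ∈ E ∪ D, EffDistinguishes e P Q := fun h =>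
    ⟨t, .inl hB.self_mem, effDistinguishes_of_minimalFor_undecided ht hP hQ h⟩
  obtain htP | htP := hP.1.mem_or_rev_mem ht.1.1 <;>
    obtain htQ | htQ := hQ.1.mem_or_rev_mem ht.1.1
  · obtain ⟨e, he, heff⟩ := hE ⟨hP, htP⟩ ⟨hQ, htQ⟩ hPQ
    exact ⟨e, .inl he, heff⟩
  · exact hdist (.inl ⟨htP, htQ⟩)
  · exact hdist (.inr ⟨htP, htQ⟩)
  · obtain ⟨e, he, heff⟩ := hD ⟨hP, htP⟩ ⟨hQ, htQ⟩ hPQ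
    exact ⟨e, .inr he, heff⟩

theorem hasEffTree_or_exists_branch [Finite U] (hA : UpClosedIn (Sk U k) A)
    (ih : ∀ B > A, UpClosedIn (Sk U k) B → HasEffTree k B)
    (ht : MinimalFor (· ∈ undecided k A) order t) :
    HasEffTree k A ∨
      ∃ E, Branch (IsNodeStar k A) t E ∧ EffSeparates E {P ∈ profilesAvoiding k A | t ∈ P} := by
  obtain ⟨r, htr, hr⟩ :=
    (Set.toFinite (Sk U k \ A)).exists_le_maximal ⟨rev_mem_Sk ht.1.1, ht.1.2.2⟩
  exact (ih _ (Set.ssubset_insert hr.1.2) (hA.insert hr)).of_insert_or_exists_branch hA hr.1.1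
    ht.1.1 (linked_of_minimalFor_undecided hA ht hr.1 htr)

theorem UpClosedIn.hasEffTree [Finite U] (hA : UpClosedIn (Sk U k) A) : HasEffTree k A := by
  induction A using WellFoundedGT.induction with
  | ind A ih =>
    by_cases hdec : ∀ s ∈ Sk U k, s ∈ A ∨ rev s ∈ A
    · exact hA.hasEffTree_of_decided hdec
    push Not at hdec
    obtain ⟨t, ht⟩ := (Set.toFinite (undecided k A)).exists_minimalFor order _ hdec
    obtain h | ⟨E, hB, hE⟩ := hasEffTree_or_exists_branch hA ih ht
    · exact h
    obtain h | ⟨D, hB', hD⟩ := hasEffTree_or_exists_branch hA ih (minimalFor_undecided_rev ht)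
    · exact h
    exact hasEffTree_of_branches ht hB hE hB' hD

end Undecided

end SepSys

theorem mainTheorem6 {U : Type*} [SubmodularUniverse U] [Finite U] (k : ℕ) :
    ∃ T : SepSys.STree (SepSys.Sk U k),
      T.IsEfficientTreeOfTangles ∧ T.OrderRespecting ∧
      (∀ P : Set U, SepSys.IsRegularProfile (SepSys.Sk U k) P →
        ∃ v : T.V, T.IsNodeOf P v ∧ T.degree v = SepSys.deltaE k P) ∧
      ∀ v : T.V, T.degree v ≤ max (SepSys.deltaEMax U k) 3 := by
  obtain ⟨E, hE, hsep⟩ := SepSys.UpClosedIn.hasEffTree (U := U) (k := k) (A := ∅)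
    ⟨Set.empty_subset _, fun _ ha => ha.elim⟩
  obtain ⟨T, hirr, hnode, hlabel⟩ := hE.exists_sTree (fun _ => SepSys.rev_mem_Sk)
    fun _ hσ => hσ.subset
  have heff : ∀ P Q, SepSys.IsRegularProfile (SepSys.Sk U k) P →
      SepSys.IsRegularProfile (SepSys.Sk U k) Q → P ≠ Q →
        ∃ e, SepSys.EffDistinguishes (T.label e) P Q := fun P Q hP hQ hPQ => by
    obtain ⟨_, he, hdist⟩ := hsep ⟨hP, Set.empty_disjoint P⟩ ⟨hQ, Set.empty_disjoint Q⟩ hPQ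
    obtain ⟨d, rfl⟩ := hlabel he
    exact ⟨d, hdist⟩
  have hstar := fun v => (hnode v).isStar
  refine ⟨T, ⟨⟨hirr, fun P Q hP hQ hPQ => (heff P Q hP hQ hPQ).imp fun _ h => h.1⟩, heff⟩,
    SepSys.STree.orderRespecting_of_isStar hirr hstar, fun P hP => ?_, fun v => ?_⟩
  · obtain ⟨v, hv⟩ := SepSys.STree.exists_isNodeOf hirr hstar hP
    obtain ⟨a, ha, -⟩ | ⟨-, hopt⟩ :=
      (hnode v).eq_singleton_or_of_subset hP (SepSys.STree.isSink_iff.1 hv.1)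
    · exact ha.elim
    · exact ⟨v, hv, (SepSys.STree.degree_eq_encard_star hirr v).trans hopt.2⟩
  · exact (SepSys.STree.degree_eq_encard_star hirr v).le.trans (hnode v).encard_le
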